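/- Let $X$ and $N$ be independent real random variables on a probability space, with $\mathbb{E}|X|<\infty$ and $N\sim\mathcal{N}(0,1)$, and let $Y=X+N$. (1) There is no polynomial $q$ with real coefficients and $\deg q>1$ such that $\mathbb{E}[X\mid Y]=q(Y)$ almost surely. (2) Suppose in addition that $X$ has finite variance. Call a $\sigma(Y)$-measurable random variable $Z$ an MMSE (minimum mean-square error) estimator of $X$ from $Y$ if $\mathbb{E}[|X-Z|^2]\le\mathbb{E}[|X-Z'|^2]$ for every $\sigma(Y)$-measurable real random variable $Z'$. Then $\mathbb{E}[X\mid Y]$ is an MMSE estimator, and every MMSE estimator $Z$ satisfies the following: there is a real polynomial $q$ with $Z=q(Y)$ almost surely if and only if $X$ is Gaussian (with positive variance) or almost surely constant. More precisely, $Z=q(Y)$ almost surely for some real polynomial $q$ of degree exactly $1$ if and only if $X$ is Gaussian with positive variance, and $Z$ is almost surely constant if and only if $X$ is almost surely constant. -/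

import Mathlib

open MeasureTheory ProbabilityTheory

/-- The σ-algebra `σ(Y)` generated by a real random variable `Y`. -/
abbrev sigmaGen {Ω : Type*} (Y : Ω → ℝ) : MeasurableSpace Ω :=
  MeasurableSpace.comap Y inferInstance

/-- `Z` is a minimum mean-square error estimator of `X` from `Y`: it is `σ(Y)`-measurable and it
minimizes the mean-square error `E[|X - Z|²]` (a value in `[0, ∞]`) among all `σ(Y)`-measurable
random variables. -/
def IsMMSEEstimator {Ω : Type*} [MeasurableSpace Ω] (P : Measure Ω) (X Y Z : Ω → ℝ) : Prop :=
  Measurable[sigmaGen Y] Z ∧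
    ∀ Z' : Ω → ℝ, Measurable[sigmaGen Y] Z' →
      ∫⁻ ω, ‖X ω - Z ω‖ₑ ^ 2 ∂P ≤ ∫⁻ ω, ‖X ω - Z' ω‖ₑ ^ 2 ∂P

/-- `X` is a (nondegenerate) Gaussian random variable. -/
def IsGaussianRV {Ω : Type*} [MeasurableSpace Ω] (P : Measure Ω) (X : Ω → ℝ) : Prop :=
  ∃ (m : ℝ) (v : NNReal), v ≠ 0 ∧ HasLaw X (gaussianReal m v) P

/-- `X` is almost surely constant. -/
def IsConstRV {Ω : Type*} [MeasurableSpace Ω] (P : Measure Ω) (X : Ω → ℝ) : Prop :=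
  ∃ c : ℝ, ∀ᵐ ω ∂P, X ω = c

/-! Let `μ` be the law of `X`, `φ` the standard normal density, and `M` the moment-generating
function of the tilt `φ μ`. Since `φ(y - x) = exp(-y²/2) · φ(x) exp(yx) · √(2π)` up to normalisation
of `φ`, Bayes' rule gives Tweedie's formula `E[X | Y = y] = M'(y) / M(y)`. Here `M` is finite,
positive and analytic on the whole line, whatever the tails of `μ`.

If `E[X | Y] = q(Y)`, then `M' = q M`, so `M` is a constant times `exp Q` with `Q' = q`. But `log
M(y) ≤ y²/2` because the normal density is at most 1, while Jensen's inequality bounds `log M` below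
by an affine function. Hence `Q` grows at most quadratically and `deg q ≤ 1`
(`natDegree_le_one_of_hasDerivAt_mgf_gaussianTilt`).

The equation `M' = r M` also determines `M` up to a factor, hence the tilt up to a factor, hence `μ`
(`eq_of_hasDerivAt_mgf_gaussianTilt`). If the conditional mean is affine, first and second moments
fix its coefficients; a Gaussian input with the mean and variance of `X` has the same conditional
mean, so `X` has that law. Pythagoras in `L²` identifies every MMSE estimator with the conditional
expectation. -/

/-- The density of `(X, Y)` with respect to `law(X) ⊗ Lebesgue`, where `Y = X + N` with `N` an
independent standard Gaussian, is `(x, y) ↦ gaussianPDF x 1 y`. -/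
theorem map_prodMk_add_gaussian {Ω : Type*} [MeasurableSpace Ω] {P : Measure Ω}
    [IsProbabilityMeasure P] {X N Y : Ω → ℝ} (hX : Measurable X) (hN : Measurable N)
    (hNlaw : HasLaw N (gaussianReal 0 1) P) (hindep : IndepFun X N P)
    (hY : ∀ ω, Y ω = X ω + N ω) :
    P.map (fun ω ↦ (X ω, Y ω)) =
      ((P.map X).prod volume).withDensity (fun p ↦ gaussianPDF p.1 1 p.2) := by
  have hμ : IsProbabilityMeasure (P.map X) := Measure.isProbabilityMeasure_map hX.aemeasurable
  have hYm : Measurable Y := by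
    rw [show Y = fun ω ↦ X ω + N ω from funext hY]
    exact hX.add hN
  have hpdf : Measurable (fun p : ℝ × ℝ ↦ gaussianPDF p.1 1 p.2) := by
    unfold gaussianPDF gaussianPDFReal
    fun_prop
  refine Measure.ext_of_lintegral _ fun φ hφ ↦ ?_
  have hprod : P.map (fun ω ↦ (X ω, N ω)) = (P.map X).prod (gaussianReal 0 1) := by
    rw [(indepFun_iff_map_prod_eq_prod_map_map hX.aemeasurable hN.aemeasurable).1 hindep,
      hNlaw.map_eq]
  calc ∫⁻ p, φ p ∂(P.map (fun ω ↦ (X ω, Y ω)))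
      = ∫⁻ ω, φ (X ω, X ω + N ω) ∂P := by
        rw [lintegral_map hφ (hX.prodMk hYm)]
        simp_rw [hY]
    _ = ∫⁻ p, φ (p.1, p.1 + p.2) ∂(P.map (fun ω ↦ (X ω, N ω))) := by
        rw [lintegral_map (by fun_prop) (hX.prodMk hN)]
    _ = ∫⁻ x, ∫⁻ n, φ (x, x + n) ∂(gaussianReal 0 1) ∂(P.map X) := by
        rw [hprod, lintegral_prod _ (by fun_prop)]
    _ = ∫⁻ x, (∫⁻ y, gaussianPDF x 1 y * φ (x, y)) ∂(P.map X) := by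
        refine lintegral_congr fun x ↦ ?_
        have h := gaussianReal_map_const_add (μ := 0) (v := 1) x
        rw [zero_add] at h
        rw [← lintegral_map (f := fun y ↦ φ (x, y)) (g := (x + ·)) (by fun_prop) (by fun_prop), h,
          gaussianReal_of_var_ne_zero _ one_ne_zero,
          lintegral_withDensity_eq_lintegral_mul _ (measurable_gaussianPDF _ _) (by fun_prop)]
        rfl
    _ = _ := by
        rw [lintegral_withDensity_eq_lintegral_mul _ hpdf hφ,
          lintegral_prod _ (by fun_prop)]
        rfl

/-! ### The Gaussian tilt and its moment-generating function -/

/-- The finite measure with density the standard Gaussian density with respect to `μ`. -/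
noncomputable def gaussianTilt (μ : Measure ℝ) : Measure ℝ := μ.withDensity (gaussianPDF 0 1)

theorem gaussianPDFReal_mul_exp (x y : ℝ) :
    gaussianPDFReal 0 1 x * Real.exp (y * x) =
      Real.exp (y ^ 2 / 2) * gaussianPDFReal x 1 y := by
  simp only [gaussianPDFReal, NNReal.coe_one, mul_one, sub_zero]
  rw [mul_assoc, ← Real.exp_add, mul_left_comm, ← Real.exp_add]
  ring_nf

theorem gaussianPDFReal_one_le_one (x y : ℝ) : gaussianPDFReal x 1 y ≤ 1 := by
  simp only [gaussianPDFReal, NNReal.coe_one, mul_one]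
  have h1 : (√(2 * Real.pi))⁻¹ ≤ 1 := by
    refine inv_le_one_of_one_le₀ (Real.one_le_sqrt.2 ?_)
    linarith [Real.pi_gt_three]
  have h2 : Real.exp (-(y - x) ^ 2 / 2) ≤ 1 :=
    Real.exp_le_one_iff.2 (by nlinarith [sq_nonneg (y - x)])
  exact mul_le_one₀ h1 (Real.exp_pos _).le h2

theorem integrable_gaussianTilt_iff {μ : Measure ℝ} {f : ℝ → ℝ} :
    Integrable f (gaussianTilt μ) ↔ Integrable (fun x ↦ gaussianPDFReal 0 1 x * f x) μ := by
  rw [gaussianTilt, integrable_withDensity_iff_integrable_smul' (measurable_gaussianPDF _ _)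
    (Filter.Eventually.of_forall fun _ ↦ gaussianPDF_lt_top)]
  simp only [toReal_gaussianPDF, smul_eq_mul]

theorem integral_gaussianTilt (μ : Measure ℝ) (f : ℝ → ℝ) :
    ∫ x, f x ∂(gaussianTilt μ) = ∫ x, gaussianPDFReal 0 1 x * f x ∂μ := by
  rw [gaussianTilt, integral_withDensity_eq_integral_toReal_smul (measurable_gaussianPDF _ _)
    (Filter.Eventually.of_forall fun _ ↦ gaussianPDF_lt_top)]
  simp only [toReal_gaussianPDF, smul_eq_mul]

/-- The Gaussian factor beats every exponential: after completing the square, the integrand is a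
constant times a bounded function of `x`. No moment of `μ` is needed. -/
theorem integrable_exp_gaussianTilt (μ : Measure ℝ) [IsFiniteMeasure μ] (y : ℝ) :
    Integrable (fun x ↦ Real.exp (y * x)) (gaussianTilt μ) := by
  rw [integrable_gaussianTilt_iff]
  simp_rw [gaussianPDFReal_mul_exp]
  refine Integrable.const_mul (Integrable.of_bound (C := 1) ?_ ?_) _
  · have : Measurable fun x ↦ gaussianPDFReal x 1 y := by
      unfold gaussianPDFReal
      fun_prop
    exact this.aestronglyMeasurable
  · refine Filter.Eventually.of_forall fun x ↦ ?_
    rw [Real.norm_of_nonneg (gaussianPDFReal_nonneg _ _ _)]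
    exact gaussianPDFReal_one_le_one x y

theorem integrableExpSet_gaussianTilt (μ : Measure ℝ) [IsFiniteMeasure μ] :
    integrableExpSet id (gaussianTilt μ) = Set.univ :=
  Set.eq_univ_of_forall fun y ↦ integrable_exp_gaussianTilt μ y

theorem isFiniteMeasure_gaussianTilt (μ : Measure ℝ) [IsFiniteMeasure μ] :
    IsFiniteMeasure (gaussianTilt μ) := by
  have h := integrable_exp_gaussianTilt μ 0
  simpa [integrable_const_iff] using h

theorem mem_interior_integrableExpSet_gaussianTilt (μ : Measure ℝ) [IsFiniteMeasure μ] (y : ℝ) :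
    y ∈ interior (integrableExpSet id (gaussianTilt μ)) := by
  simp [integrableExpSet_gaussianTilt]

theorem gaussianTilt_ne_zero (μ : Measure ℝ) [NeZero μ] : gaussianTilt μ ≠ 0 := by
  intro h
  rw [gaussianTilt, withDensity_eq_zero_iff (measurable_gaussianPDF _ _).aemeasurable] at h
  have h' : ∀ᵐ _ ∂μ, False := h.mono fun x hx ↦ (gaussianPDF_pos 0 one_ne_zero x).ne' hx
  rw [Filter.eventually_false_iff_eq_bot, ae_eq_bot] at h'
  exact NeZero.ne μ h'

theorem mgf_gaussianTilt_pos (μ : Measure ℝ) [IsFiniteMeasure μ] [NeZero μ] (y : ℝ) :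
    0 < mgf id (gaussianTilt μ) y :=
  mgf_pos' (gaussianTilt_ne_zero μ) (integrable_exp_gaussianTilt μ y)

theorem mgf_gaussianTilt_le (μ : Measure ℝ) [IsProbabilityMeasure μ] (y : ℝ) :
    mgf id (gaussianTilt μ) y ≤ Real.exp (y ^ 2 / 2) := by
  have hint := integrable_gaussianTilt_iff.1 (integrable_exp_gaussianTilt μ y)
  calc mgf id (gaussianTilt μ) y
      = ∫ x, gaussianPDFReal 0 1 x * Real.exp (y * x) ∂μ := integral_gaussianTilt μ _
    _ ≤ ∫ _, Real.exp (y ^ 2 / 2) ∂μ := by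
        refine integral_mono hint (integrable_const _) fun x ↦ ?_
        simp only [gaussianPDFReal_mul_exp]
        exact mul_le_of_le_one_right (Real.exp_pos _).le (gaussianPDFReal_one_le_one x y)
    _ = Real.exp (y ^ 2 / 2) := by simp

/-! ### Tweedie's formula -/

/-- Tweedie's formula in terms of the moment-generating function of the Gaussian tilt of the law
of `X`. -/
theorem hasDerivAt_mgf_gaussianTilt_of_condExp {Ω : Type*} [MeasurableSpace Ω] {P : Measure Ω}
    [IsProbabilityMeasure P] {X N Y : Ω → ℝ} (hX : Measurable X) (hN : Measurable N)
    (hXint : Integrable X P)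
    (hNlaw : HasLaw N (gaussianReal 0 1) P) (hindep : IndepFun X N P)
    (hY : ∀ ω, Y ω = X ω + N ω) {r : ℝ → ℝ} (hr : Continuous r)
    (hcond : ∀ᵐ ω ∂P, (P[X | sigmaGen Y]) ω = r (Y ω)) (y : ℝ) :
    HasDerivAt (mgf id (gaussianTilt (P.map X))) (r y * mgf id (gaussianTilt (P.map X)) y) y := by
  have hμ : IsProbabilityMeasure (P.map X) := Measure.isProbabilityMeasure_map hX.aemeasurable
  set μ := P.map X with hμdef
  have hYm : Measurable Y := by
    rw [show Y = fun ω ↦ X ω + N ω from funext hY]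
    exact hX.add hN
  have hle : sigmaGen Y ≤ ‹MeasurableSpace Ω› := hYm.comap_le
  have hpdf : Measurable (fun p : ℝ × ℝ ↦ gaussianPDF p.1 1 p.2) := by
    unfold gaussianPDF gaussianPDFReal
    fun_prop
  have hlaw := map_prodMk_add_gaussian hX hN hNlaw hindep hY
  have hrint : Integrable (fun ω ↦ r (Y ω)) P := integrable_condExp.congr hcond
  have hD : Integrable (fun p : ℝ × ℝ ↦ gaussianPDFReal p.1 1 p.2 * (p.1 - r p.2))
      (μ.prod volume) := by
    have h1 : Integrable (fun p : ℝ × ℝ ↦ p.1 - r p.2) (P.map (fun ω ↦ (X ω, Y ω))) := by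
      rw [integrable_map_measure (by fun_prop) (by fun_prop)]
      exact hXint.sub hrint
    rw [hlaw, integrable_withDensity_iff_integrable_smul' hpdf
      (Filter.Eventually.of_forall fun _ ↦ gaussianPDF_lt_top)] at h1
    simpa only [toReal_gaussianPDF, smul_eq_mul] using h1
  -- Integrating `X - r(Y)` over the events `Y ∈ s` gives zero; by Fubini, the inner integral over
  -- `x` then has zero integral on each such `s`.
  have hG : (fun y ↦ ∫ x, gaussianPDFReal x 1 y * (x - r y) ∂μ) =ᵐ[volume] fun _ ↦ 0 := by
    refine Integrable.ae_eq_of_forall_setIntegral_eq _ _ hD.integral_prod_right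
      (integrable_zero _ _ _) fun s hs _ ↦ ?_
    have h2 : ∫ ω in Y ⁻¹' s, (X ω - r (Y ω)) ∂P = 0 := by
      rw [integral_sub hXint.integrableOn hrint.integrableOn, sub_eq_zero,
        ← setIntegral_condExp hle hXint ⟨s, hs, rfl⟩]
      exact setIntegral_congr_ae (hYm hs) (hcond.mono fun ω h _ ↦ h)
    have h3 : ∫ p in Set.univ ×ˢ s, (p.1 - r p.2) ∂(P.map (fun ω ↦ (X ω, Y ω))) = 0 := by
      rw [setIntegral_map (MeasurableSet.univ.prod hs) (by fun_prop) (by fun_prop)]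
      convert h2 using 3
      ext ω
      simp
    rw [hlaw, setIntegral_withDensity_eq_setIntegral_toReal_smul hpdf
      (Filter.Eventually.of_forall fun _ ↦ gaussianPDF_lt_top) _
      (MeasurableSet.univ.prod hs), ← Measure.prod_restrict, Measure.restrict_univ] at h3
    simp only [toReal_gaussianPDF, smul_eq_mul] at h3
    rw [integral_prod_symm _ (by
      have := hD.integrableOn (s := Set.univ ×ˢ s)
      rwa [IntegrableOn, ← Measure.prod_restrict, Measure.restrict_univ] at this)] at h3
    simpa using h3
  have hder (y : ℝ) := hasDerivAt_mgf (mem_interior_integrableExpSet_gaussianTilt μ y)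
  have han : AnalyticOnNhd ℝ (mgf id (gaussianTilt μ)) Set.univ := by
    have := analyticOnNhd_mgf (X := id) (μ := gaussianTilt μ)
    simpa [integrableExpSet_gaussianTilt] using this
  have hkey : ∀ y, ∫ x, gaussianPDFReal x 1 y * (x - r y) ∂μ =
      Real.exp (-(y ^ 2 / 2)) * (deriv (mgf id (gaussianTilt μ)) y
        - r y * mgf id (gaussianTilt μ) y) := by
    intro y
    have i1 : Integrable (fun x ↦ x * Real.exp (y * x)) (gaussianTilt μ) := by
      simpa using integrable_pow_mul_exp_of_mem_interior_integrableExpSet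
        (mem_interior_integrableExpSet_gaussianTilt μ y) 1
    have i2 := integrable_exp_gaussianTilt μ y
    rw [(hder y).deriv]
    simp only [mgf, id]
    rw [← integral_const_mul (r y), ← integral_sub i1 (i2.const_mul _), integral_gaussianTilt,
      ← integral_const_mul]
    refine integral_congr_ae (Filter.Eventually.of_forall fun x ↦ ?_)
    have e : gaussianPDFReal x 1 y =
        Real.exp (-(y ^ 2 / 2)) * (gaussianPDFReal 0 1 x * Real.exp (y * x)) := by
      rw [gaussianPDFReal_mul_exp, ← mul_assoc, ← Real.exp_add]
      simp
    simp only [e]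
    ring
  have hae : (fun y ↦ deriv (mgf id (gaussianTilt μ)) y) =ᵐ[volume]
      fun y ↦ r y * mgf id (gaussianTilt μ) y := by
    filter_upwards [hG] with y hy
    rw [hkey] at hy
    exact sub_eq_zero.1 ((mul_eq_zero.1 hy).resolve_left (Real.exp_ne_zero _))
  have hcont : Continuous (mgf id (gaussianTilt μ)) := continuousOn_univ.1 han.continuousOn
  have hcont' : Continuous (deriv (mgf id (gaussianTilt μ))) :=
    continuousOn_univ.1 han.deriv.continuousOn
  -- Both sides are continuous, so the almost-everywhere identity holds at every `y`.
  have heq := Measure.eq_of_ae_eq hae hcont' (hr.mul hcont)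
  have h := (hder y).differentiableAt.hasDerivAt
  rwa [congrFun heq y] at h

/-! ### The differential equation for the mgf and polynomial growth -/

/-- Two solutions of the same first-order homogeneous linear ODE are proportional. -/
theorem eq_const_mul_of_hasDerivAt {f g r : ℝ → ℝ} (hf : ∀ y, HasDerivAt f (r y * f y) y)
    (hg : ∀ y, HasDerivAt g (r y * g y) y) (hpos : ∀ y, g y ≠ 0) (y : ℝ) :
    f y = f 0 / g 0 * g y := by
  have h : ∀ y, HasDerivAt (fun y ↦ f y / g y) 0 y := fun y ↦ by
    have h' := (hf y).fun_div (hg y) (hpos y)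
    rwa [show r y * f y * g y - f y * (r y * g y) = 0 by ring, zero_div] at h'
  have hc := is_const_of_deriv_eq_zero (fun y ↦ (h y).differentiableAt) (fun y ↦ (h y).deriv) y 0
  rw [← hc, div_mul_cancel₀ _ (hpos y)]

theorem exists_derivative_eq (q : Polynomial ℝ) : ∃ Q : Polynomial ℝ, Q.derivative = q := by
  induction q using Polynomial.induction_on' with
  | add p q hp hq =>
    obtain ⟨P, rfl⟩ := hp
    obtain ⟨Q, rfl⟩ := hq
    exact ⟨P + Q, Polynomial.derivative_add⟩
  | monomial n a =>
    refine ⟨Polynomial.monomial (n + 1) (a / (n + 1)), ?_⟩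
    rw [Polynomial.derivative_monomial]
    have : (n : ℝ) + 1 ≠ 0 := by positivity
    simp [div_mul_cancel₀ _ this]

/-- In degree above 2, `y² + 1 = o(Q)` at infinity; with `Q = O(y² + 1)` this makes `Q = o(Q)`,
absurd for a nonzero polynomial. -/
theorem natDegree_le_two_of_abs_eval_le {Q : Polynomial ℝ} {K : ℝ}
    (h : ∀ y, |Q.eval y| ≤ K * (y ^ 2 + 1)) : Q.natDegree ≤ 2 := by
  by_contra! hdeg
  have hQ : Q ≠ 0 := by
    rintro rfl
    simp at hdeg
  set R : Polynomial ℝ := Polynomial.X ^ 2 + 1 with hR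
  have hRdeg : R.degree < Q.degree := by
    rw [Polynomial.degree_eq_natDegree hQ]
    refine lt_of_le_of_lt (b := (2 : WithBot ℕ)) (by rw [hR]; compute_degree) ?_
    exact_mod_cast hdeg
  have hlo := Polynomial.isLittleO_atTop_of_degree_lt _ _ hRdeg
  have hO : Q.eval =O[Filter.atTop] R.eval := by
    refine Asymptotics.IsBigO.of_bound K (Filter.Eventually.of_forall fun y ↦ ?_)
    have : (0 : ℝ) ≤ y ^ 2 + 1 := by positivity
    simpa [hR, Real.norm_eq_abs, abs_of_nonneg this] using h y
  have hfr : ∃ᶠ y in Filter.atTop, Q.eval y ≠ 0 := by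
    refine Filter.Eventually.frequently ?_
    simpa [Polynomial.IsRoot] using Polynomial.eventually_atTop_not_isRoot Q hQ
  exact Asymptotics.isLittleO_irrefl hfr (hO.trans_isLittleO hlo)

/-- If the logarithmic derivative of the moment-generating function of a Gaussian tilt is a
polynomial, then that polynomial has degree at most one. -/
theorem natDegree_le_one_of_hasDerivAt_mgf_gaussianTilt {μ : Measure ℝ} [IsProbabilityMeasure μ]
    {q : Polynomial ℝ} (h : ∀ y, HasDerivAt (mgf id (gaussianTilt μ))
      (q.eval y * mgf id (gaussianTilt μ) y) y) : q.natDegree ≤ 1 := by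
  obtain ⟨Q, rfl⟩ := exists_derivative_eq q
  set M := mgf id (gaussianTilt μ) with hM
  have hpos : ∀ y, 0 < M y := mgf_gaussianTilt_pos μ
  have hfin := isFiniteMeasure_gaussianTilt μ
  -- `s = M'(0) / M(0)` is the mean of the normalised tilt.
  set s := Q.derivative.eval 0 with hs
  have hexp := eq_const_mul_of_hasDerivAt (f := M) (g := fun y ↦ Real.exp (Q.eval y)) h
    (fun y ↦ by simpa [mul_comm] using (Q.hasDerivAt y).exp) (fun y ↦ (Real.exp_pos _).ne')
  have hlog : ∀ y, Real.log (M y) = Real.log (M 0) - Q.eval 0 + Q.eval y := fun y ↦ by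
    rw [hexp y, Real.log_mul (div_pos (hpos 0) (Real.exp_pos _)).ne' (Real.exp_pos _).ne',
      Real.log_div (hpos 0).ne' (Real.exp_pos _).ne', Real.log_exp, Real.log_exp]
  have hupper : ∀ y, Real.log (M y) ≤ y ^ 2 / 2 := fun y ↦ by
    rw [Real.log_le_iff_le_exp (hpos y)]
    exact mgf_gaussianTilt_le μ y
  -- Jensen's inequality by hand: integrate the tangent-line bound `exp t ≥ 1 + t` at `t = y x - s
  -- y`.
  have hlower : ∀ y, Real.log (M 0) + s * y ≤ Real.log (M y) := fun y ↦ by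
    rw [Real.le_log_iff_exp_le (hpos y), Real.exp_add, Real.exp_log (hpos 0)]
    have hx : Integrable (fun x : ℝ ↦ x) (gaussianTilt μ) := by
      simpa using integrable_pow_mul_exp_of_mem_interior_integrableExpSet
        (mem_interior_integrableExpSet_gaussianTilt μ 0) 1
    have hmean : ∫ x, x ∂(gaussianTilt μ) = s * M 0 := by
      have h0 := hasDerivAt_mgf (mem_interior_integrableExpSet_gaussianTilt μ 0)
      simpa using h0.unique (h 0)
    have hmass : ∫ _, (1 : ℝ) ∂(gaussianTilt μ) = M 0 := by
      simp [hM]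
    calc M 0 * Real.exp (s * y)
        = ∫ x, Real.exp (s * y) * (y * x + (1 - s * y) * 1) ∂(gaussianTilt μ) := by
          rw [integral_const_mul, integral_add (hx.const_mul y)
            ((integrable_const (1 : ℝ)).const_mul _), integral_const_mul, integral_const_mul,
            hmean, hmass]
          ring
      _ ≤ ∫ x, Real.exp (y * x) ∂(gaussianTilt μ) := by
          refine integral_mono (((hx.const_mul y).add
            ((integrable_const (1 : ℝ)).const_mul _)).const_mul _)
            (integrable_exp_gaussianTilt μ y) fun x ↦ ?_
          have h1 := Real.add_one_le_exp (y * x - s * y)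
          calc Real.exp (s * y) * (y * x + (1 - s * y) * 1)
              ≤ Real.exp (s * y) * Real.exp (y * x - s * y) := by
                gcongr
                linarith
            _ = Real.exp (y * x) := by
                rw [← Real.exp_add]
                ring_nf
      _ = M y := rfl
  have hQ : Q.natDegree ≤ 2 := by
    refine natDegree_le_two_of_abs_eval_le
      (K := |Real.log (M 0)| + |Q.eval 0| + |s| + 1) fun y ↦ ?_
    have h1 := hlog y
    have h2 := hupper y
    have h3 := hlower y
    have h4 := neg_abs_le (Real.log (M 0))
    have h4' := le_abs_self (Real.log (M 0))
    have h5 := neg_abs_le (Q.eval 0)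
    have h5' := le_abs_self (Q.eval 0)
    have h6 : |s * y| ≤ |s| * (y ^ 2 + 1) := by
      rw [abs_mul]
      gcongr
      nlinarith [sq_nonneg (|y| - 1), sq_abs y]
    have h6' := neg_abs_le (s * y)
    have h7 : 0 ≤ |Real.log (M 0)| * y ^ 2 := by positivity
    have h8 : 0 ≤ |Q.eval 0| * y ^ 2 := by positivity
    have h9 : 0 ≤ |s| * (y ^ 2 + 1) := by positivity
    have h10 := sq_nonneg y
    rw [abs_le]
    constructor <;> nlinarith
  exact Q.natDegree_derivative_le.trans (by omega)

/-! ### Recovering the law from the tilt -/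

/-- A probability measure is determined by the logarithmic derivative of the moment-generating
function of its Gaussian tilt. -/
theorem eq_of_hasDerivAt_mgf_gaussianTilt {μ₁ μ₂ : Measure ℝ} [IsProbabilityMeasure μ₁]
    [IsProbabilityMeasure μ₂] {r : ℝ → ℝ}
    (h₁ : ∀ y, HasDerivAt (mgf id (gaussianTilt μ₁)) (r y * mgf id (gaussianTilt μ₁) y) y)
    (h₂ : ∀ y, HasDerivAt (mgf id (gaussianTilt μ₂)) (r y * mgf id (gaussianTilt μ₂) y) y) :
    μ₁ = μ₂ := by
  have hf₁ := isFiniteMeasure_gaussianTilt μ₁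
  have hf₂ := isFiniteMeasure_gaussianTilt μ₂
  set c : ℝ := mgf id (gaussianTilt μ₁) 0 / mgf id (gaussianTilt μ₂) 0
  have hc : 0 < c := div_pos (mgf_gaussianTilt_pos μ₁ 0) (mgf_gaussianTilt_pos μ₂ 0)
  set C : NNReal := c.toNNReal
  have hC : (C : ℝ) = c := Real.coe_toNNReal c hc.le
  have hmgf : mgf id (gaussianTilt μ₁) = mgf id (C • gaussianTilt μ₂) := by
    funext y
    rw [eq_const_mul_of_hasDerivAt h₁ h₂ (fun y ↦ (mgf_gaussianTilt_pos μ₂ y).ne') y]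
    simp only [mgf, integral_smul_nnreal_measure, NNReal.smul_def, hC, smul_eq_mul, c]
  have hne : C • gaussianTilt μ₂ ≠ 0 := by
    intro h0
    have := mgf_gaussianTilt_pos μ₁ 0
    rw [hmgf, h0] at this
    simp at this
  have htilt : gaussianTilt μ₁ = C • gaussianTilt μ₂ := by
    -- The real mgf is finite everywhere, so equality on the line extends analytically to the whole
    -- complex plane, which determines the measure.
    refine Measure.ext_of_complexMGF_id_eq (funext fun z ↦ ?_)
    exact eqOn_complexMGF_of_mgf' hmgf (iff_of_false (gaussianTilt_ne_zero μ₁) hne)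
      (mem_interior_integrableExpSet_gaussianTilt μ₁ z.re)
  -- The tilting density is positive and finite, so the tilt can be undone.
  have hinv (μ : Measure ℝ) :
      (gaussianTilt μ).withDensity (fun x ↦ (gaussianPDF 0 1 x)⁻¹) = μ :=
    withDensity_inv_same (measurable_gaussianPDF _ _)
      (Filter.Eventually.of_forall fun x ↦ (gaussianPDF_pos 0 one_ne_zero x).ne')
      (Filter.Eventually.of_forall fun _ ↦ gaussianPDF_ne_top)
  have hμ : μ₁ = C • μ₂ := by
    rw [← hinv μ₁, htilt]
    conv_rhs => rw [← hinv μ₂]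
    exact withDensity_smul_measure (C : ENNReal) _
  -- Compare total masses.
  have h1 : C = 1 := by
    have := congrArg (fun μ ↦ μ Set.univ) hμ
    simpa [eq_comm] using this
  rw [hμ, h1, one_smul]

/-! ### Least-squares estimation by the conditional expectation -/

section MMSE

variable {Ω : Type*} {m m0 : MeasurableSpace Ω} {P : Measure Ω}

/-- The error of the conditional expectation is orthogonal to the square-integrable
`m`-measurable functions. -/
theorem integral_sub_condExp_mul_eq_zero [IsFiniteMeasure P] (hm : m ≤ m0) {X g : Ω → ℝ}
    (hX : MemLp X 2 P)
    (hgm : StronglyMeasurable[m] g) (hg : MemLp g 2 P) :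
    ∫ ω, (X ω - (P[X | m]) ω) * g ω ∂P = 0 := by
  have hC : MemLp (P[X | m]) 2 P := hX.condExp (by norm_num)
  have hXg : Integrable (X * g) P := hX.integrable_mul hg
  have hCg : Integrable (P[X | m] * g) P := hC.integrable_mul hg
  have h1 : P[X * g | m] =ᵐ[P] P[X | m] * g :=
    condExp_mul_of_stronglyMeasurable_right hgm hXg (hX.integrable (by norm_num))
  calc ∫ ω, (X ω - (P[X | m]) ω) * g ω ∂P
      = ∫ ω, (X * g) ω - (P[X | m] * g) ω ∂P := by
        simp only [Pi.mul_apply, sub_mul]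
    _ = 0 := by
        rw [integral_sub hXg hCg, sub_eq_zero, ← integral_condExp hm, integral_congr_ae h1]

theorem lintegral_enorm_sq_eq_ofReal {f : Ω → ℝ} (hf : MemLp f 2 P) :
    ∫⁻ ω, ‖f ω‖ₑ ^ 2 ∂P = ENNReal.ofReal (∫ ω, f ω ^ 2 ∂P) := by
  rw [ofReal_integral_eq_lintegral_ofReal hf.integrable_sq
    (Filter.Eventually.of_forall fun ω ↦ sq_nonneg (f ω))]
  refine lintegral_congr fun ω ↦ ?_
  rw [Real.enorm_eq_ofReal_abs, ← ENNReal.ofReal_pow (abs_nonneg _), sq_abs]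

theorem memLp_two_of_lintegral_enorm_sq_lt_top {f : Ω → ℝ} (hf : AEStronglyMeasurable f P)
    (h : ∫⁻ ω, ‖f ω‖ₑ ^ 2 ∂P < ⊤) : MemLp f 2 P := by
  refine ⟨hf, ?_⟩
  rw [eLpNorm_lt_top_iff_lintegral_rpow_enorm_lt_top (by norm_num) (by norm_num)]
  simpa using h

/-- Pythagoras' theorem for the conditional expectation. -/
theorem integral_sub_sq_eq_add [IsFiniteMeasure P] (hm : m ≤ m0) {X Z : Ω → ℝ}
    (hX : MemLp X 2 P)
    (hZm : StronglyMeasurable[m] Z) (hZ : MemLp Z 2 P) :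
    ∫ ω, (X ω - Z ω) ^ 2 ∂P =
      ∫ ω, (X ω - (P[X | m]) ω) ^ 2 ∂P + ∫ ω, ((P[X | m]) ω - Z ω) ^ 2 ∂P := by
  have hC : MemLp (P[X | m]) 2 P := hX.condExp (by norm_num)
  have h0 := integral_sub_condExp_mul_eq_zero hm hX (stronglyMeasurable_condExp.sub hZm)
    (hC.sub hZ)
  have i1 : Integrable (fun ω ↦ (X ω - (P[X | m]) ω) ^ 2) P := (hX.sub hC).integrable_sq
  have i2 : Integrable (fun ω ↦ ((P[X | m]) ω - Z ω) ^ 2) P := (hC.sub hZ).integrable_sq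
  have i3 : Integrable (fun ω ↦ (X ω - (P[X | m]) ω) * (P[X | m] - Z) ω) P :=
    (hX.sub hC).integrable_mul (hC.sub hZ)
  calc ∫ ω, (X ω - Z ω) ^ 2 ∂P
      = ∫ ω, ((X ω - (P[X | m]) ω) ^ 2 + ((P[X | m]) ω - Z ω) ^ 2
          + 2 * ((X ω - (P[X | m]) ω) * (P[X | m] - Z) ω)) ∂P := by
        refine integral_congr_ae (Filter.Eventually.of_forall fun ω ↦ ?_)
        simp only [Pi.sub_apply]
        ring
    _ = _ := by
        rw [integral_add (by exact i1.add i2) (i3.const_mul 2), integral_add i1 i2,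
          integral_const_mul, h0, mul_zero, add_zero]

end MMSE

section MMSEEstimator

variable {Ω : Type*} [MeasurableSpace Ω] {P : Measure Ω} [IsProbabilityMeasure P]
  {X Y Z : Ω → ℝ}

theorem isMMSEEstimator_condExp (hY : Measurable Y) (hX : MemLp X 2 P) :
    IsMMSEEstimator P X Y (P[X | sigmaGen Y]) := by
  refine ⟨stronglyMeasurable_condExp.measurable, fun Z hZ ↦ ?_⟩
  have hle : sigmaGen Y ≤ ‹MeasurableSpace Ω› := hY.comap_le
  have hC : MemLp (P[X | sigmaGen Y]) 2 P := hX.condExp (by norm_num)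
  -- An infinite error needs no argument; a finite one forces `Z` into `L²`, where Pythagoras
  -- applies.
  rcases eq_top_or_lt_top (∫⁻ ω, ‖X ω - Z ω‖ₑ ^ 2 ∂P) with h | h
  · simp [h]
  have hXZ : MemLp (X - Z) 2 P := memLp_two_of_lintegral_enorm_sq_lt_top
    (hX.1.sub (hZ.mono hle le_rfl).aestronglyMeasurable) h
  have hZ2 : MemLp Z 2 P := by simpa using hX.sub hXZ
  have e1 := lintegral_enorm_sq_eq_ofReal (hX.sub hC)
  have e2 := lintegral_enorm_sq_eq_ofReal hXZ
  simp only [Pi.sub_apply] at e1 e2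
  rw [e1, e2, integral_sub_sq_eq_add hle hX hZ.stronglyMeasurable hZ2]
  refine ENNReal.ofReal_le_ofReal (le_add_of_nonneg_right ?_)
  exact integral_nonneg fun ω ↦ sq_nonneg _

/-- By Pythagoras, the excess error of `Z` is the squared `L²` distance to the conditional
expectation, and minimality makes it vanish. -/
theorem IsMMSEEstimator.ae_eq_condExp (hY : Measurable Y) (hX : MemLp X 2 P)
    (hZ : IsMMSEEstimator P X Y Z) : Z =ᵐ[P] P[X | sigmaGen Y] := by
  have hle : sigmaGen Y ≤ ‹MeasurableSpace Ω› := hY.comap_le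
  have hC : MemLp (P[X | sigmaGen Y]) 2 P := hX.condExp (by norm_num)
  have hmin := hZ.2 _ (stronglyMeasurable_condExp (μ := P) (f := X)).measurable
  have e1 := lintegral_enorm_sq_eq_ofReal (hX.sub hC)
  simp only [Pi.sub_apply] at e1
  have hXZ : MemLp (X - Z) 2 P := by
    refine memLp_two_of_lintegral_enorm_sq_lt_top
      (hX.1.sub (hZ.1.mono hle le_rfl).aestronglyMeasurable) (hmin.trans_lt ?_)
    rw [e1]
    exact ENNReal.ofReal_lt_top
  have hZ2 : MemLp Z 2 P := by simpa using hX.sub hXZ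
  have e2 := lintegral_enorm_sq_eq_ofReal hXZ
  simp only [Pi.sub_apply] at e2
  rw [e1, e2, ENNReal.ofReal_le_ofReal_iff (integral_nonneg fun ω ↦ sq_nonneg _),
    integral_sub_sq_eq_add hle hX hZ.1.stronglyMeasurable hZ2] at hmin
  have hi : Integrable (fun ω ↦ ((P[X | sigmaGen Y]) ω - Z ω) ^ 2) P := (hC.sub hZ2).integrable_sq
  have h0 : ∫ ω, ((P[X | sigmaGen Y]) ω - Z ω) ^ 2 ∂P = 0 :=
    le_antisymm (by linarith) (integral_nonneg fun ω ↦ sq_nonneg _)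
  rw [integral_eq_zero_iff_of_nonneg (fun ω ↦ sq_nonneg _) hi] at h0
  filter_upwards [h0] with ω hω
  have := pow_eq_zero_iff (two_ne_zero) |>.1 hω
  linarith

end MMSEEstimator

/-! ### Gaussian inputs and affine conditional means -/

section GaussianInput

variable {Ω : Type*} [MeasurableSpace Ω] {P : Measure Ω} [IsProbabilityMeasure P]
  {X N Y : Ω → ℝ}

/-- The conditional mean of a Gaussian input given its noisy observation is affine. -/
theorem condExp_gaussian_ae_eq (hX : Measurable X) (hN : Measurable N)
    (hNlaw : HasLaw N (gaussianReal 0 1) P) (hindep : IndepFun X N P)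
    (hY : ∀ ω, Y ω = X ω + N ω) {m : ℝ} {v : NNReal} (hXlaw : HasLaw X (gaussianReal m v) P) :
    ∀ᵐ ω ∂P, (P[X | sigmaGen Y]) ω = v / (v + 1) * Y ω + m / (v + 1) := by
  obtain rfl : Y = fun ω ↦ X ω + N ω := funext hY
  set Y : Ω → ℝ := fun ω ↦ X ω + N ω with hYdef
  have hYadd : Y = X + N := rfl
  have hYm : Measurable Y := hX.add hN
  have hle : sigmaGen Y ≤ ‹MeasurableSpace Ω› := hYm.comap_le
  have hX2 := hXlaw.hasGaussianLaw.memLp_two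
  have hN2 := hNlaw.hasGaussianLaw.memLp_two
  have hY2 : MemLp Y 2 P := hX2.add hN2
  have hv : (v : ℝ) + 1 ≠ 0 := by positivity
  -- The regression coefficient `Cov(X, Y) / Var(Y)`: it makes `W = X - aY` uncorrelated with `Y`,
  -- hence independent of it by joint Gaussianity.
  set a : ℝ := v / (v + 1) with ha
  set W : Ω → ℝ := fun ω ↦ X ω - a * Y ω with hW
  have hWm : Measurable W := hX.sub (hYm.const_mul a)
  have hpair : HasGaussianLaw (fun ω ↦ (X ω, N ω)) P :=
    hindep.hasGaussianLaw hXlaw.hasGaussianLaw hNlaw.hasGaussianLaw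
  have hWY : HasGaussianLaw (fun ω ↦ (W ω, Y ω)) P := by
    have := hpair.map_fun
      (((ContinuousLinearMap.fst ℝ ℝ ℝ) - a • (ContinuousLinearMap.fst ℝ ℝ ℝ
        + ContinuousLinearMap.snd ℝ ℝ ℝ)).prod
        (ContinuousLinearMap.fst ℝ ℝ ℝ + ContinuousLinearMap.snd ℝ ℝ ℝ))
    simpa [hW, hYdef, mul_add] using this
  have hvX : cov[X, X; P] = v := by
    rw [covariance_self hX.aemeasurable, hXlaw.variance_eq, variance_id_gaussianReal]
  have hvN : cov[N, N; P] = 1 := by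
    rw [covariance_self hN.aemeasurable, hNlaw.variance_eq, variance_id_gaussianReal]
    simp
  have hXN : cov[X, N; P] = 0 := hindep.covariance_eq_zero hX2 hN2
  have hXY : cov[X, Y; P] = v := by
    rw [hYadd, covariance_add_right hX2 hX2 hN2, hvX, hXN, add_zero]
  have hNY : cov[N, Y; P] = 1 := by
    rw [hYadd, covariance_add_right hN2 hX2 hN2, hvN, covariance_comm, hXN, zero_add]
  have hYY : cov[Y, Y; P] = v + 1 := by
    nth_rewrite 1 [hYadd]
    rw [covariance_add_left hX2 hN2 hY2, hXY, hNY]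
  have hcov : cov[W, Y; P] = 0 := by
    rw [hW, covariance_fun_sub_left hX2 (hY2.const_mul a) hY2, covariance_const_mul_left, hXY, hYY,
      ha, div_mul_cancel₀ _ hv, sub_self]
  have hWind : IndepFun W Y P := hWY.indepFun_of_covariance_eq_zero hcov
  have hEX : P[X] = m := by rw [hXlaw.integral_eq, integral_id_gaussianReal]
  have hEN : P[N] = 0 := by rw [hNlaw.integral_eq, integral_id_gaussianReal]
  have hXi := hX2.integrable one_le_two
  have hNi := hN2.integrable one_le_two
  have hYi := hY2.integrable one_le_two
  have hEW : P[W] = m / (v + 1) := by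
    have hEY : P[Y] = m := by
      rw [hYdef, integral_add hXi hNi, hEX, hEN, add_zero]
    rw [hW, integral_sub hXi (hYi.const_mul a), integral_const_mul, hEX, hEY, ha]
    field_simp
    ring
  have hYsm : StronglyMeasurable[sigmaGen Y] (fun ω ↦ a * Y ω) :=
    ((comap_measurable Y).const_mul a).stronglyMeasurable
  have h1 : P[W | sigmaGen Y] =ᵐ[P] fun _ ↦ P[W] :=
    condExp_indep_eq hWm.comap_le hle (comap_measurable W).stronglyMeasurable hWind
  have h2 : P[W | sigmaGen Y] =ᵐ[P] P[X | sigmaGen Y] - P[fun ω ↦ a * Y ω | sigmaGen Y] :=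
    condExp_sub hXi (hYi.const_mul a) _
  rw [condExp_of_stronglyMeasurable hle hYsm (hYi.const_mul a)] at h2
  filter_upwards [h1, h2] with ω hω1 hω2
  rw [hω1, hEW, Pi.sub_apply] at hω2
  linarith

/-- If a square-integrable input has affine conditional mean given its noisy observation, then it
is Gaussian, possibly degenerate. -/
theorem hasLaw_gaussianReal_of_condExp_affine (hX : Measurable X) (hN : Measurable N)
    (hX2 : MemLp X 2 P)
    (hNlaw : HasLaw N (gaussianReal 0 1) P) (hindep : IndepFun X N P)
    (hY : ∀ ω, Y ω = X ω + N ω) {a b : ℝ}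
    (hcond : ∀ᵐ ω ∂P, (P[X | sigmaGen Y]) ω = a * Y ω + b) :
    ∃ (m : ℝ) (v : NNReal), HasLaw X (gaussianReal m v) P ∧ (v : ℝ) = a * (v + 1) := by
  have hYm : Measurable Y := by
    rw [show Y = fun ω ↦ X ω + N ω from funext hY]
    exact hX.add hN
  have hle : sigmaGen Y ≤ ‹MeasurableSpace Ω› := hYm.comap_le
  have hN2 := hNlaw.hasGaussianLaw.memLp_two
  have hY2 : MemLp Y 2 P := (hX2.add hN2).ae_eq (.of_forall fun ω ↦ (hY ω).symm)
  have hXi := hX2.integrable one_le_two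
  have hNi := hN2.integrable one_le_two
  have hYi := hY2.integrable one_le_two
  set m : ℝ := P[X] with hm
  set v : NNReal := ⟨variance X P, variance_nonneg X P⟩ with hv
  have hv1 : (v : ℝ) + 1 ≠ 0 := by positivity
  have hEN : P[N] = 0 := by rw [hNlaw.integral_eq, integral_id_gaussianReal]
  have hEY : P[Y] = m := by
    rw [show Y = fun ω ↦ X ω + N ω from funext hY, integral_add hXi hNi, hEN, add_zero]
  have hcovXY : cov[X, Y; P] = v := by
    rw [show Y = X + N from funext hY, covariance_add_right hX2 hX2 hN2,
      hindep.covariance_eq_zero hX2 hN2, add_zero, covariance_self hX.aemeasurable]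
    rfl
  have hcovYY : cov[Y, Y; P] = v + 1 := by
    rw [covariance_self hYm.aemeasurable, show Y = fun ω ↦ X ω + N ω from funext hY,
      hindep.variance_fun_add hX2 hN2, hNlaw.variance_eq, variance_id_gaussianReal]
    rfl
  have hmean : m = a * m + b := by
    have h1 : ∫ ω, (a * Y ω + b) ∂P = m := by
      rw [← integral_congr_ae hcond, integral_condExp hle]
    rw [integral_add (hYi.const_mul a) (integrable_const b), integral_const_mul, hEY] at h1
    simpa using h1.symm
  -- The error is orthogonal to `Y`; with the mean equation this reads `Cov(X, Y) = a Var(Y)`.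
  have hvar : (v : ℝ) = a * (v + 1) := by
    have h0 := integral_sub_condExp_mul_eq_zero hle hX2 (comap_measurable Y).stronglyMeasurable hY2
    have h1 : ∫ ω, (X ω - (a * Y ω + b)) * Y ω ∂P = 0 := by
      rw [← h0]
      refine integral_congr_ae (hcond.mono fun ω hω ↦ ?_)
      simp only [hω]
    have i1 : Integrable (fun ω ↦ X ω * Y ω) P := hX2.integrable_mul hY2
    have i2 : Integrable (fun ω ↦ Y ω * Y ω) P := hY2.integrable_mul hY2
    have h2 : ∫ ω, X ω * Y ω ∂P = a * ∫ ω, Y ω * Y ω ∂P + b * m := by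
      have : ∫ ω, (X ω - (a * Y ω + b)) * Y ω ∂P =
          ∫ ω, X ω * Y ω ∂P - (a * ∫ ω, Y ω * Y ω ∂P + b * m) := by
        rw [← hEY, ← integral_const_mul, ← integral_const_mul,
          ← integral_add (i2.const_mul a) (hYi.const_mul b),
          ← integral_sub i1 (by exact (i2.const_mul a).add (hYi.const_mul b))]
        refine integral_congr_ae (.of_forall fun ω ↦ ?_)
        simp only
        ring
      linarith
    rw [covariance_eq_sub hX2 hY2] at hcovXY
    rw [covariance_eq_sub hY2 hY2] at hcovYY
    simp only [Pi.mul_apply, hEY] at hcovXY hcovYY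
    rw [h2] at hcovXY
    linear_combination (-1 : ℝ) * hcovXY + a * hcovYY - m * hmean
  have ha : a = v / (v + 1) := by
    rw [eq_div_iff hv1]
    exact hvar.symm
  have hb : b = m / (v + 1) := by
    rw [eq_div_iff hv1]
    linear_combination (-(v : ℝ) - 1) * hmean + m * hvar
  refine ⟨m, v, ⟨hX.aemeasurable, ?_⟩, hvar⟩
  have hμ : IsProbabilityMeasure (P.map X) := Measure.isProbabilityMeasure_map hX.aemeasurable
  -- compare with the same observation of a Gaussian input having the mean and variance of `X`
  let P' : Measure (ℝ × ℝ) := (gaussianReal m v).prod (gaussianReal 0 1)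
  have hX' : HasLaw (Prod.fst : ℝ × ℝ → ℝ) (gaussianReal m v) P' :=
    ⟨measurable_fst.aemeasurable, by simp [P']⟩
  have hN' : HasLaw (Prod.snd : ℝ × ℝ → ℝ) (gaussianReal 0 1) P' :=
    ⟨measurable_snd.aemeasurable, by simp [P']⟩
  have hind' : IndepFun (Prod.fst : ℝ × ℝ → ℝ) Prod.snd P' :=
    indepFun_prod (X := fun x : ℝ ↦ x) (Y := fun x : ℝ ↦ x) measurable_id measurable_id
  have hcond' := condExp_gaussian_ae_eq (Y := fun p : ℝ × ℝ ↦ p.1 + p.2) measurable_fst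
    measurable_snd hN' hind' (fun _ ↦ rfl) hX'
  rw [← ha, ← hb] at hcond'
  have hder := hasDerivAt_mgf_gaussianTilt_of_condExp (r := fun y ↦ a * y + b) hX hN hXi hNlaw
    hindep hY (by fun_prop) hcond
  have hder' := hasDerivAt_mgf_gaussianTilt_of_condExp (r := fun y ↦ a * y + b) measurable_fst
    measurable_snd hX'.hasGaussianLaw.integrable hN' hind' (fun _ ↦ rfl) (by fun_prop) hcond'
  rw [hX'.map_eq] at hder'
  exact eq_of_hasDerivAt_mgf_gaussianTilt hder hder'

end GaussianInput

/-! ### The main theorem -/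

theorem isConstRV_of_hasLaw_gaussianReal_zero {Ω : Type*} [MeasurableSpace Ω] {P : Measure Ω}
    {X : Ω → ℝ} {m : ℝ} (h : HasLaw X (gaussianReal m 0) P) : IsConstRV P X := by
  refine ⟨m, ?_⟩
  have h' := h.map_eq
  rw [gaussianReal_zero_var] at h'
  have : ∀ᵐ x ∂(P.map X), x = m := by
    rw [h']
    exact (ae_dirac_iff (measurableSet_singleton m)).2 rfl
  exact ae_of_ae_map h.aemeasurable this

theorem theorem1 {Ω : Type*} [MeasurableSpace Ω] (P : Measure Ω) [IsProbabilityMeasure P]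
    (X N Y : Ω → ℝ) (hX : Measurable X) (hN : Measurable N)
    (hXint : Integrable X P)
    (hNlaw : HasLaw N (gaussianReal 0 1) P)
    (hindep : IndepFun X N P)
    (hY : ∀ ω, Y ω = X ω + N ω) :
    -- the conditional expectation is not a polynomial of degree greater than one
    (∀ q : Polynomial ℝ, 1 < q.natDegree →
      ¬ (∀ᵐ ω ∂P, (P[X | sigmaGen Y]) ω = q.eval (Y ω))) ∧
    -- for finite variance, the MMSE estimator exists and is given by the conditional
    -- expectation, and it is a polynomial if and only if the input is Gaussian (linear case)
    -- or constant (constant case)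
    (MemLp X 2 P →
      IsMMSEEstimator P X Y (P[X | sigmaGen Y]) ∧
      ∀ Z : Ω → ℝ, IsMMSEEstimator P X Y Z →
        ((∃ q : Polynomial ℝ, ∀ᵐ ω ∂P, Z ω = q.eval (Y ω)) ↔
          (IsGaussianRV P X ∨ IsConstRV P X)) ∧
        ((∃ q : Polynomial ℝ, q.natDegree = 1 ∧ ∀ᵐ ω ∂P, Z ω = q.eval (Y ω)) ↔
          IsGaussianRV P X) ∧
        (IsConstRV P Z ↔ IsConstRV P X)) := by
  have hYm : Measurable Y := by
    rw [show Y = fun ω ↦ X ω + N ω from funext hY]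
    exact hX.add hN
  have hle : sigmaGen Y ≤ ‹MeasurableSpace Ω› := hYm.comap_le
  have hμ : IsProbabilityMeasure (P.map X) := Measure.isProbabilityMeasure_map hX.aemeasurable
  have hdeg : ∀ q : Polynomial ℝ, (∀ᵐ ω ∂P, (P[X | sigmaGen Y]) ω = q.eval (Y ω)) →
      q.natDegree ≤ 1 := fun q hq ↦
    natDegree_le_one_of_hasDerivAt_mgf_gaussianTilt
      (hasDerivAt_mgf_gaussianTilt_of_condExp hX hN hXint hNlaw hindep hY q.continuous hq)
  refine ⟨fun q hq h ↦ (hdeg q h).not_gt hq, fun hX2 ↦ ⟨isMMSEEstimator_condExp hYm hX2,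
    fun Z hZ ↦ ?_⟩⟩
  have hZC := hZ.ae_eq_condExp hYm hX2
  have hpoly : ∀ q : Polynomial ℝ, (∀ᵐ ω ∂P, Z ω = q.eval (Y ω)) →
      q.natDegree ≤ 1 ∧ ∃ (m : ℝ) (v : NNReal), HasLaw X (gaussianReal m v) P ∧
        (v : ℝ) = q.coeff 1 * (v + 1) := fun q hq ↦ by
    have hC : ∀ᵐ ω ∂P, (P[X | sigmaGen Y]) ω = q.eval (Y ω) := by
      filter_upwards [hZC, hq] with ω h1 h2
      rw [← h1, h2]
    have h1 := hdeg q hC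
    refine ⟨h1, hasLaw_gaussianReal_of_condExp_affine (b := q.coeff 0) hX hN hX2 hNlaw hindep hY ?_⟩
    filter_upwards [hC] with ω hω
    rw [hω, Polynomial.eval_eq_sum_range' (Nat.lt_succ_of_le h1)]
    simp [Finset.sum_range_succ]
    ring
  have hlin : (∃ q : Polynomial ℝ, q.natDegree = 1 ∧ ∀ᵐ ω ∂P, Z ω = q.eval (Y ω)) ↔
      IsGaussianRV P X := by
    constructor
    · rintro ⟨q, hq1, hq⟩
      obtain ⟨-, m, v, hlaw, hv⟩ := hpoly q hq
      refine ⟨m, v, ?_, hlaw⟩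
      -- Zero variance would kill the linear coefficient, contradicting degree exactly 1.
      rintro rfl
      have h0 : q.coeff 1 = 0 := by simpa using hv.symm
      rw [← hq1, Polynomial.coeff_natDegree, Polynomial.leadingCoeff_eq_zero] at h0
      simp [h0] at hq1
    · rintro ⟨m, v, hv, hlaw⟩
      refine ⟨Polynomial.C ((v : ℝ) / (v + 1)) * Polynomial.X + Polynomial.C (m / (v + 1)),
        Polynomial.natDegree_linear ?_, ?_⟩
      · have : (0 : ℝ) < v := NNReal.coe_pos.2 (pos_iff_ne_zero.2 hv)
        positivity
      · filter_upwards [hZC, condExp_gaussian_ae_eq hX hN hNlaw hindep hY hlaw] with ω h1 h2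
        rw [h1, h2]
        simp
  have hconst : IsConstRV P Z ↔ IsConstRV P X := by
    constructor
    · rintro ⟨c, hc⟩
      -- A constant polynomial has zero linear coefficient, which forces `v = 0`.
      obtain ⟨-, m, v, hlaw, hv⟩ := hpoly (Polynomial.C c) (by simpa using hc)
      obtain rfl : v = 0 := by simpa [Polynomial.coeff_C] using hv
      exact isConstRV_of_hasLaw_gaussianReal_zero hlaw
    · rintro ⟨c, hc⟩
      refine ⟨c, ?_⟩
      have h1 : P[X | sigmaGen Y] =ᵐ[P] P[fun _ ↦ c | sigmaGen Y] := condExp_congr_ae hc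
      rw [condExp_const hle] at h1
      exact hZC.trans h1
  refine ⟨⟨?_, ?_⟩, hlin, hconst⟩
  · rintro ⟨q, hq⟩
    obtain ⟨-, m, v, hlaw, -⟩ := hpoly q hq
    rcases eq_or_ne v 0 with rfl | hv
    · exact .inr (isConstRV_of_hasLaw_gaussianReal_zero hlaw)
    · exact .inl ⟨m, v, hv, hlaw⟩
  · rintro (h | h)
    · obtain ⟨q, -, hq⟩ := hlin.2 h
      exact ⟨q, hq⟩
    · obtain ⟨c, hc⟩ := hconst.2 h
      exact ⟨Polynomial.C c, by simpa using hc⟩
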